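/- Let $\varepsilon>0$, $\Delta>0$, $n\ge 1$ an integer, $b\in\mathbb R$, $\Sigma\ge 0$, and let $\nu_\varepsilon$ be a L\'evy measure on $\mathbb R$ (that is, $\nu_\varepsilon(\{0\})=0$ and $\int (x^2\wedge 1)\,\nu_\varepsilon(dx)<\infty$) with support in $[-\varepsilon,\varepsilon]$. Let $X(\varepsilon)$ be a L\'evy process with L\'evy triplet $(b,\Sigma^2,\nu_\varepsilon)$ with respect to the truncation function $x\mapsto x\mathbf 1_{|x|\le 1}$, i.e. a c\`adl\`ag process started at $0$ with independent and stationary increments and $$\mathbb E\big[e^{iuX_t(\varepsilon)}\big]=\exp\Big(t\Big(iub-\tfrac{\Sigma^2u^2}{2}+\int\big(e^{iux}-1-iux\mathbf 1_{|x|\le1}\big)\nu_\varepsilon(dx)\Big)\Big),\qquad t\ge 0,\ u\in\mathbb R.$$ Put $\sigma^2(\varepsilon)=\int x^2\,\nu_\varepsilon(dx)$, $\lambda_{0,\varepsilon}=\nu_\varepsilon(\{0<|x|\le\varepsilon\})\in[0,\infty]$, $b(\varepsilon)=b+\int_{1<|x|\le\varepsilon}x\,\nu_\varepsilon(dx)$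 (so $b(\varepsilon)=b$ if $\varepsilon\le1$), $$\tilde X_\Delta(\varepsilon)=\frac{X_\Delta(\varepsilon)-\Delta b(\varepsilon)}{\sqrt{\Delta(\Sigma^2+\sigma^2(\varepsilon))}},\qquad \Psi_\varepsilon(t)=\mathbb E\big[e^{it\tilde X_\Delta(\varepsilon)}\big]-e^{-\Delta\lambda_{0,\varepsilon}}\mathbf 1_{\{\Sigma=0\}},$$ with $e^{-\infty}=0$. For every $c_\Sigma>0$ there is a constant $c>0$, depending only on $c_\Sigma$, such that the following holds for all $\varepsilon,\Delta,n,b,\Sigma,\nu_\varepsilon,X(\varepsilon)$ as above. If $\lambda_{0,\varepsilon}>1/\Delta$, $\varepsilon\le\sqrt{\Delta(\Sigma^2+\sigma^2(\varepsilon))}$ and $c_\Sigma\Sigma\ge\sigma(\varepsilon)$, then for all integers $k\in[0,401\log(e\vee n)]$ the function $\Psi_\varepsilon$ is $k$ times continuously differentiable, $|\Psi_\varepsilon^{(k)}|^2$ is integrable on $(c\log(e\vee n),\infty)$, and $$\int_{c\log(e\vee n)}^{\infty}\big|\Psi_\varepsilon^{(k)}(t)\big|^2\,dt\le k!\,n^{-4}.$$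 -/

import Mathlib

open MeasureTheory ProbabilityTheory Filter Topology
open scoped NNReal ENNReal

noncomputable section

/-- A Lévy measure on `ℝ`: no mass at `0` and `∫ (x² ∧ 1) ν(dx) < ∞`. -/
structure IsLevyMeasure (ν : Measure ℝ) : Prop where
  measure_singleton_zero : ν {0} = 0
  lintegral_lt_top : ∫⁻ x, ENNReal.ofReal (min (x ^ 2) 1) ∂ν < ∞

/-- The Lévy–Khintchine exponent of the triplet `(b, S², ν)`, with truncation function
`x ↦ x 1_{|x| ≤ 1}`. -/
def levyExponent (b S : ℝ) (ν : Measure ℝ) (u : ℝ) : ℂ :=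
  Complex.I * u * b - (S : ℂ) ^ 2 * (u : ℂ) ^ 2 / 2 +
    ∫ x : ℝ, (Complex.exp (Complex.I * u * x) - 1 -
      Complex.I * u * (if |x| ≤ 1 then (x : ℂ) else 0)) ∂ν

/-- `X` is, under `P`, a (càdlàg) Lévy process with Lévy triplet `(b, S², ν)`. -/
structure IsLevyProcess {Ω : Type*} [MeasurableSpace Ω] (X : ℝ≥0 → Ω → ℝ) (P : Measure Ω)
    (b S : ℝ) (ν : Measure ℝ) : Prop where
  measurable : ∀ t, Measurable (X t)
  zero : ∀ᵐ ω ∂P, X 0 ω = 0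
  indepIncrements : HasIndepIncrements X P
  stationaryIncrements : ∀ s t, IdentDistrib (fun ω ↦ X (s + t) ω - X s ω) (X t) P P
  cadlag : ∀ᵐ ω ∂P, ∀ t : ℝ≥0, ContinuousWithinAt (fun s ↦ X s ω) (Set.Ici t) t ∧
    ∃ l : ℝ, Tendsto (fun s ↦ X s ω) (𝓝[<] t) (𝓝 l)
  charFun_eq : ∀ (t : ℝ≥0) (u : ℝ),
    charFun (P.map (X t)) u = Complex.exp ((t : ℂ) * levyExponent b S ν u)

/-- The intensity `λ_{η,ε}` of the jumps with size in `(η, ε]`; for `η = 0` it may be infinite. -/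
def jumpIntensity (ν : Measure ℝ) (η ε : ℝ) : ℝ≥0∞ :=
  ν {x | η < |x| ∧ |x| ≤ ε}

/-- `σ²(ε) = ∫_{|x| ≤ ε} x² ν(dx)`. -/
def smallJumpVar (ν : Measure ℝ) (ε : ℝ) : ℝ :=
  ∫ x in {x : ℝ | |x| ≤ ε}, x ^ 2 ∂ν

/-- The drift `b(ε)`. -/
def smallJumpDrift (b : ℝ) (ν : Measure ℝ) (ε : ℝ) : ℝ :=
  b + if ε ≤ 1 then -∫ x in {x : ℝ | ε < |x| ∧ |x| ≤ 1}, x ∂ν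
    else ∫ x in {x : ℝ | 1 < |x| ∧ |x| ≤ ε}, x ∂ν

/-- `e^{-Δ λ}` for `λ ∈ [0, ∞]`, which is `0` when `λ = ∞` (and `Δ > 0`). -/
def noJumpProb (Δ : ℝ) (l : ℝ≥0∞) : ℝ :=
  if l = ∞ then 0 else Real.exp (-(Δ * l.toReal))

/-- The rescaled increment `(X_Δ - Δ b(ε)) / √(Δ (S² + σ²(ε)))` of a process `X` with Lévy
triplet `(b, S², ν)`. -/
def rescaledIncrement {Ω : Type*} (X : ℝ≥0 → Ω → ℝ) (b S : ℝ) (ν : Measure ℝ) (ε : ℝ) (Δ : ℝ≥0)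
    (ω : Ω) : ℝ :=
  (X Δ ω - Δ * smallJumpDrift b ν ε) / √(Δ * (S ^ 2 + smallJumpVar ν ε))

/-- `Ψ_ε(t)`: the characteristic function of the rescaled increment, minus
`e^{-Δ λ_{0,ε}} 1_{S = 0}`. -/
def Psi {Ω : Type*} [MeasurableSpace Ω] (X : ℝ≥0 → Ω → ℝ) (P : Measure Ω) (b S : ℝ)
    (ν : Measure ℝ) (ε : ℝ) (Δ : ℝ≥0) (t : ℝ) : ℂ :=
  ∫ ω, Complex.exp (Complex.I * t * rescaledIncrement X b S ν ε Δ ω) ∂P -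
    if S = 0 then (noJumpProb Δ (jumpIntensity ν 0 ε) : ℂ) else 0

end

/-! As the jumps are bounded, the characteristic function of the centred, rescaled increment extends
to an entire function `F`. Within distance 1 of a real `t ≥ 2`, the Gaussian part makes `F` at most
`exp (-a t²/8 + 4)`, where `a` bounds from below the Gaussian share of the variance; the jumps cost
only a bounded factor (`norm_rescaledCharFunExtension_le`). Cauchy's estimate on the unit circle
about `t` bounds the `k`-th derivative by `k!` times this. Beyond a large multiple of `L = log (e ∨
n)`, the Gaussian decay absorbs the second `k!`, the factor `n⁴` and `e^t`
(`norm_iteratedDeriv_sq_le`), leaving an integrable `e^{-t}`. -/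

/-! ### The compensated cumulant on the complex plane. -/

/-- The integrand `e^{wx} - 1 - wx` integrated against `ν`. -/
noncomputable def compensatedCumulant (ν : Measure ℝ) (w : ℂ) : ℂ :=
  ∫ x : ℝ, (Complex.exp (w * x) - 1 - w * x) ∂ν

theorem norm_exp_sub_one_le_mul_exp (w : ℂ) :
    ‖Complex.exp w - 1‖ ≤ ‖w‖ * Real.exp ‖w‖ := by
  simpa using Complex.norm_exp_sub_sum_le_norm_mul_exp w 1

theorem norm_exp_sub_one_sub_id_le_sq_mul_exp (w : ℂ) :
    ‖Complex.exp w - 1 - w‖ ≤ ‖w‖ ^ 2 * Real.exp ‖w‖ := by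
  simpa [Finset.sum_range_succ, sub_sub] using Complex.norm_exp_sub_sum_le_norm_mul_exp w 2

/-- Oscillation only lowers the real part, since `Re e^w ≤ e^{Re w}`. The bound is therefore free of
`Im w`, which carries the large frequency. -/
theorem re_exp_sub_one_sub_id_le (w : ℂ) :
    (Complex.exp w - 1 - w).re ≤ w.re ^ 2 * Real.exp |w.re| := by
  have h1 : (Complex.exp w).re ≤ Real.exp w.re :=
    (Complex.re_le_norm _).trans_eq (Complex.norm_exp w)
  have h2 := norm_exp_sub_one_sub_id_le_sq_mul_exp (w.re : ℂ)
  have h3 : Complex.exp (w.re : ℂ) - 1 - (w.re : ℂ) = ((Real.exp w.re - 1 - w.re : ℝ) : ℂ) := by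
    push_cast; rfl
  rw [h3, Complex.norm_real, Complex.norm_real, Real.norm_eq_abs, Real.norm_eq_abs, sq_abs] at h2
  have h4 := le_abs_self (Real.exp w.re - 1 - w.re)
  simp only [Complex.sub_re, Complex.one_re]
  linarith

theorem norm_compensated_integrand_le {ε x R : ℝ} {w : ℂ} (hx : |x| ≤ ε) (hw : ‖w‖ ≤ R) :
    ‖Complex.exp (w * x) - 1 - w * x‖ ≤ R ^ 2 * Real.exp (R * ε) * x ^ 2 := by
  refine (norm_exp_sub_one_sub_id_le_sq_mul_exp _).trans ?_
  have hR : 0 ≤ R := (norm_nonneg w).trans hw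
  rw [norm_mul, Complex.norm_real, Real.norm_eq_abs, mul_pow, sq_abs]
  calc ‖w‖ ^ 2 * x ^ 2 * Real.exp (‖w‖ * |x|) ≤ R ^ 2 * x ^ 2 * Real.exp (R * ε) := by
        gcongr
    _ = _ := by ring

theorem integrable_compensated_integrand {ν : Measure ℝ} {ε : ℝ}
    (hε : ∀ᵐ x ∂ν, |x| ≤ ε) (h2 : Integrable (fun x : ℝ ↦ x ^ 2) ν) (w : ℂ) :
    Integrable (fun x : ℝ ↦ Complex.exp (w * x) - 1 - w * x) ν := by
  refine (h2.const_mul (‖w‖ ^ 2 * Real.exp (‖w‖ * ε))).mono'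
    (Continuous.aestronglyMeasurable (by fun_prop)) ?_
  filter_upwards [hε] with x hx using norm_compensated_integrand_le hx le_rfl

theorem differentiable_compensatedCumulant {ν : Measure ℝ} {ε : ℝ}
    (hε : ∀ᵐ x ∂ν, |x| ≤ ε) (h2 : Integrable (fun x : ℝ ↦ x ^ 2) ν) :
    Differentiable ℂ (compensatedCumulant ν) := by
  intro w₀
  have key := hasDerivAt_integral_of_dominated_loc_of_deriv_le (μ := ν) (𝕜 := ℂ)
    (F := fun w x ↦ Complex.exp (w * (x : ℝ)) - 1 - w * x)
    (F' := fun w x ↦ (x : ℂ) * (Complex.exp (w * x) - 1)) (x₀ := w₀)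
    (bound := fun x ↦ (‖w₀‖ + 1) * Real.exp ((‖w₀‖ + 1) * ε) * x ^ 2)
    (Metric.ball_mem_nhds w₀ one_pos)
    (Eventually.of_forall fun w ↦ (integrable_compensated_integrand hε h2 w).aestronglyMeasurable)
    (integrable_compensated_integrand hε h2 w₀)
    (Continuous.aestronglyMeasurable (by fun_prop))
    (by
      filter_upwards [hε] with x hx w hw
      have hw' : ‖w‖ ≤ ‖w₀‖ + 1 := by
        have := norm_le_norm_add_norm_sub' w w₀
        rw [Metric.mem_ball, dist_eq_norm] at hw
        linarith
      have := norm_exp_sub_one_le_mul_exp (w * x)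
      rw [norm_mul, Complex.norm_real, Real.norm_eq_abs]
      rw [norm_mul, Complex.norm_real, Real.norm_eq_abs] at this
      calc |x| * ‖Complex.exp (w * x) - 1‖ ≤ |x| * (‖w‖ * |x| * Real.exp (‖w‖ * |x|)) := by gcongr
        _ ≤ |x| * ((‖w₀‖ + 1) * |x| * Real.exp ((‖w₀‖ + 1) * ε)) := by gcongr
        _ = (‖w₀‖ + 1) * Real.exp ((‖w₀‖ + 1) * ε) * |x| ^ 2 := by ring
        _ = _ := by rw [sq_abs])
    (h2.const_mul _)
    (by
      refine Eventually.of_forall fun x w _ ↦ ?_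
      have h : HasDerivAt (fun w : ℂ ↦ w * (x : ℂ)) (x : ℂ) w := by
        simpa using (hasDerivAt_id w).mul_const (x : ℂ)
      rw [mul_sub_one, mul_comm (x : ℂ)]
      exact (h.cexp.sub_const 1).sub h)
  exact key.2.differentiableAt

theorem re_compensatedCumulant_le {ν : Measure ℝ} {ε : ℝ}
    (hε : ∀ᵐ x ∂ν, |x| ≤ ε) (h2 : Integrable (fun x : ℝ ↦ x ^ 2) ν) (w : ℂ) :
    (compensatedCumulant ν w).re ≤ w.re ^ 2 * Real.exp (|w.re| * ε) * ∫ x, x ^ 2 ∂ν := by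
  have hI := integrable_compensated_integrand hε h2 w
  have hre : (compensatedCumulant ν w).re
      = ∫ x : ℝ, (Complex.exp (w * x) - 1 - w * x).re ∂ν :=
    (integral_re hI).symm
  rw [hre, ← integral_const_mul]
  refine integral_mono_ae hI.re (h2.const_mul _) ?_
  filter_upwards [hε] with x hx
  have h := re_exp_sub_one_sub_id_le (w * x)
  rw [Complex.re_mul_ofReal, abs_mul, mul_pow] at h
  refine h.trans ?_
  calc w.re ^ 2 * x ^ 2 * Real.exp (|w.re| * |x|) ≤ w.re ^ 2 * x ^ 2 * Real.exp (|w.re| * ε) := by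
        gcongr
    _ = _ := by ring

/-! ### Drift and exponent for boundedly supported jumps. -/

theorem IsLevyMeasure.integrable_sq {ν : Measure ℝ} (hν : IsLevyMeasure ν) {ε : ℝ}
    (hε : ∀ᵐ x ∂ν, |x| ≤ ε) : Integrable (fun x : ℝ ↦ x ^ 2) ν := by
  have h1 : Integrable (fun x : ℝ ↦ min (x ^ 2) 1) ν := by
    refine ⟨Continuous.aestronglyMeasurable (by fun_prop), ?_⟩
    rw [hasFiniteIntegral_iff_ofReal (Eventually.of_forall fun x ↦ by positivity)]
    exact hν.lintegral_lt_top
  refine (h1.const_mul (1 + ε ^ 2)).mono' (Continuous.aestronglyMeasurable (by fun_prop)) ?_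
  filter_upwards [hε] with x hx
  have hx2 : x ^ 2 ≤ ε ^ 2 := sq_le_sq.2 (hx.trans (le_abs_self ε))
  rw [Real.norm_of_nonneg (sq_nonneg x)]
  rcases le_total (x ^ 2) 1 with h | h
  · rw [min_eq_left h]; nlinarith [sq_nonneg x, sq_nonneg ε, mul_nonneg (sq_nonneg x) (sq_nonneg ε)]
  · rw [min_eq_right h]; linarith

theorem smallJumpVar_eq_integral {ν : Measure ℝ} {ε : ℝ} (hε : ∀ᵐ x ∂ν, |x| ≤ ε) :
    smallJumpVar ν ε = ∫ x, x ^ 2 ∂ν := by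
  rw [smallJumpVar, Measure.restrict_eq_self_of_ae_mem (s := {x : ℝ | |x| ≤ ε}) hε]

theorem smallJumpVar_nonneg (ν : Measure ℝ) (ε : ℝ) : 0 ≤ smallJumpVar ν ε :=
  integral_nonneg fun x ↦ sq_nonneg x

theorem smallJumpDrift_eq {ν : Measure ℝ} {ε : ℝ} (hε : ∀ᵐ x ∂ν, |x| ≤ ε) (b : ℝ) :
    smallJumpDrift b ν ε = b + ∫ x in {x : ℝ | 1 < |x|}, x ∂ν := by
  rw [smallJumpDrift]
  congr 1
  split_ifs with h
  · rw [setIntegral_measure_zero, setIntegral_measure_zero, neg_zero]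
    · refine measure_eq_zero_iff_ae_notMem.2 ?_
      filter_upwards [hε] with x hx h1
      exact absurd (h1 : 1 < |x|) (by linarith)
    · refine measure_eq_zero_iff_ae_notMem.2 ?_
      filter_upwards [hε] with x hx h1
      exact absurd h1.1 (not_lt.2 hx)
  · refine setIntegral_congr_set ?_
    filter_upwards [hε] with x hx
    exact propext ⟨fun h ↦ h.1, fun h ↦ ⟨h, hx⟩⟩

/-- Compensating all jumps instead of those with `|x| ≤ 1` moves `∫_{|x|>1} x dν` into the drift,
which turns `b` into `b(ε)`. -/
theorem levyExponent_eq_compensatedCumulant {ν : Measure ℝ} {ε : ℝ}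
    (hε : ∀ᵐ x ∂ν, |x| ≤ ε) (h2 : Integrable (fun x : ℝ ↦ x ^ 2) ν) (b S u : ℝ) :
    levyExponent b S ν u = Complex.I * u * smallJumpDrift b ν ε - (S : ℂ) ^ 2 * (u : ℂ) ^ 2 / 2 +
      compensatedCumulant ν (Complex.I * u) := by
  have hm : MeasurableSet {x : ℝ | 1 < |x|} := measurableSet_lt measurable_const (by fun_prop)
  -- Here `|x| ≤ x²` on `|x| > 1`.
  have hbig : Integrable ({x : ℝ | 1 < |x|}.indicator fun x ↦ x) ν := by
    refine h2.mono' (measurable_id.indicator hm).aestronglyMeasurable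
      (Eventually.of_forall fun x ↦ ?_)
    by_cases hx : 1 < |x|
    · rw [Set.indicator_of_mem (by exact hx), Real.norm_eq_abs, ← sq_abs]
      nlinarith
    · rw [Set.indicator_of_notMem (by exact hx), norm_zero]
      positivity
  have hsplit : ∀ x : ℝ, Complex.exp (Complex.I * u * x) - 1 -
      Complex.I * u * (if |x| ≤ 1 then (x : ℂ) else 0)
      = (Complex.exp (Complex.I * u * x) - 1 - Complex.I * u * x)
        + Complex.I * u * (({x : ℝ | 1 < |x|}.indicator (fun x ↦ x) x : ℝ) : ℂ) := by
    intro x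
    by_cases hx : 1 < |x|
    · rw [Set.indicator_of_mem (by exact hx), if_neg (not_le.2 hx)]; ring
    · rw [Set.indicator_of_notMem (by exact hx), if_pos (not_lt.1 hx)]; simp
  rw [levyExponent, smallJumpDrift_eq hε, integral_congr_ae (Eventually.of_forall hsplit),
    integral_add (f := fun x : ℝ ↦ Complex.exp (Complex.I * u * x) - 1 - Complex.I * u * x)
      (g := fun x : ℝ ↦ Complex.I * u * (({x : ℝ | 1 < |x|}.indicator (fun x ↦ x) x : ℝ) : ℂ))
      (integrable_compensated_integrand hε h2 _) (hbig.ofReal.const_mul _),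
    integral_const_mul, integral_complex_ofReal, integral_indicator hm, compensatedCumulant]
  push_cast
  ring

/-! ### The entire extension and its Gaussian bound. -/

/-- The entire function `exp (-Δ S² z² / (2 s²) + Δ ∫ (e^{izx/s} - 1 - izx/s) ν(dx))`, which
extends the characteristic function of the increment centred at its mean and divided by `s`. -/
noncomputable def rescaledCharFunExtension (S : ℝ) (ν : Measure ℝ) (Δ s : ℝ) (z : ℂ) : ℂ :=
  Complex.exp (Δ * (-((S : ℂ) ^ 2 * (z / s) ^ 2 / 2) + compensatedCumulant ν (Complex.I * (z / s))))

theorem differentiable_rescaledCharFunExtension {ν : Measure ℝ} {ε : ℝ}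
    (hε : ∀ᵐ x ∂ν, |x| ≤ ε) (h2 : Integrable (fun x : ℝ ↦ x ^ 2) ν) (S Δ s : ℝ) :
    Differentiable ℂ (rescaledCharFunExtension S ν Δ s) := by
  have h := differentiable_compensatedCumulant hε h2
  unfold rescaledCharFunExtension
  fun_prop

theorem Psi_eq_rescaledCharFunExtension {Ω : Type*} [MeasurableSpace Ω] {P : Measure Ω}
    {X : ℝ≥0 → Ω → ℝ} {b S : ℝ} {ν : Measure ℝ} {ε : ℝ}
    (hS : S ≠ 0) (hX : IsLevyProcess X P b S ν)
    (hε : ∀ᵐ x ∂ν, |x| ≤ ε) (h2 : Integrable (fun x : ℝ ↦ x ^ 2) ν) (Δ : ℝ≥0) :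
    Psi X P b S ν ε Δ = fun t : ℝ ↦
      rescaledCharFunExtension S ν Δ (√(Δ * (S ^ 2 + smallJumpVar ν ε))) t := by
  funext t
  set s := √(Δ * (S ^ 2 + smallJumpVar ν ε)) with hs
  set d := smallJumpDrift b ν ε with hd
  have hexp : ∀ ω, Complex.exp (Complex.I * t * rescaledIncrement X b S ν ε Δ ω)
      = Complex.exp (-(Complex.I * (t / s) * Δ * d))
        * Complex.exp (((t / s : ℝ) : ℂ) * X Δ ω * Complex.I) := by
    intro ω
    rw [← Complex.exp_add, rescaledIncrement, ← hs, ← hd]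
    congr 1
    push_cast
    ring
  have hchar := hX.charFun_eq Δ (t / s)
  rw [charFun_apply_real, integral_map (hX.measurable Δ).aemeasurable
    (Continuous.aestronglyMeasurable (by fun_prop))] at hchar
  rw [Psi, if_neg hS, sub_zero, integral_congr_ae (Eventually.of_forall hexp), integral_const_mul,
    hchar, ← Complex.exp_add, rescaledCharFunExtension,
    levyExponent_eq_compensatedCumulant hε h2, ← hd]
  congr 1
  push_cast
  ring

theorem norm_rescaledCharFunExtension_le {ν : Measure ℝ} {ε S Δ s a : ℝ}
    (hε : ∀ᵐ x ∂ν, |x| ≤ ε) (h2 : Integrable (fun x : ℝ ↦ x ^ 2) ν)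
    (hΔ : 0 ≤ Δ) (hs : 0 < s) (hs2 : s ^ 2 = Δ * (S ^ 2 + ∫ x, x ^ 2 ∂ν)) (hεs : ε ≤ s)
    (ha : a * s ^ 2 ≤ Δ * S ^ 2) {t : ℝ} (ht : 2 ≤ t) {z : ℂ} (hz : ‖z - t‖ ≤ 1) :
    ‖rescaledCharFunExtension S ν Δ s z‖ ≤ Real.exp (-(a * t ^ 2 / 8) + 4) := by
  set σ2 := ∫ x, x ^ 2 ∂ν with hσ
  have hσ0 : 0 ≤ σ2 := integral_nonneg fun x ↦ sq_nonneg x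
  rw [rescaledCharFunExtension, Complex.norm_exp]
  refine Real.exp_le_exp.2 ?_
  have hre : |z.re - t| ≤ 1 := by simpa using (Complex.abs_re_le_norm (z - t)).trans hz
  have him : |z.im| ≤ 1 := by simpa using (Complex.abs_im_le_norm (z - t)).trans hz
  have him2 : z.im ^ 2 ≤ 1 := (sq_le_one_iff_abs_le_one _).2 him
  have hτ : t ^ 2 / 4 ≤ z.re ^ 2 := by
    have := (abs_le.1 hre).1
    nlinarith
  have hw : (Complex.I * (z / s)).re = -(z.im / s) := by
    simp [Complex.div_ofReal_im]
  have hJ := re_compensatedCumulant_le hε h2 (Complex.I * (z / s))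
  rw [hw, abs_neg, neg_sq, div_pow] at hJ
  -- The exponent is at most 1 because `|Im z| ≤ 1` and `ε ≤ s`.
  have hexp : Real.exp (|z.im / s| * ε) ≤ 3 := by
    refine (Real.exp_le_exp.2 (?_ : _ ≤ (1 : ℝ))).trans Real.exp_one_lt_three.le
    rw [abs_div, abs_of_pos hs, div_mul_eq_mul_div, div_le_one hs]
    nlinarith [abs_nonneg z.im]
  have hJ' : (compensatedCumulant ν (Complex.I * (z / s))).re ≤ 3 * σ2 / s ^ 2 := by
    refine hJ.trans ?_
    calc z.im ^ 2 / s ^ 2 * Real.exp (|z.im / s| * ε) * σ2 ≤ 1 / s ^ 2 * 3 * σ2 := by gcongr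
      _ = _ := by ring
  have hsq : (-((S : ℂ) ^ 2 * (z / s) ^ 2 / 2)).re
      = -(S ^ 2 * (z.re ^ 2 - z.im ^ 2) / (2 * s ^ 2)) := by
    have : -((S : ℂ) ^ 2 * (z / s) ^ 2 / 2) = ((-(S ^ 2 / (2 * s ^ 2)) : ℝ) : ℂ) * z ^ 2 := by
      push_cast
      field_simp
    rw [this, Complex.re_ofReal_mul, sq z, Complex.mul_re]
    ring
  have hs2pos : 0 < s ^ 2 := by positivity
  rw [Complex.re_ofReal_mul, Complex.add_re, hsq]
  calc Δ * (-(S ^ 2 * (z.re ^ 2 - z.im ^ 2) / (2 * s ^ 2))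
        + (compensatedCumulant ν (Complex.I * (z / s))).re)
      ≤ Δ * (-(S ^ 2 * (t ^ 2 / 4 - 1) / (2 * s ^ 2)) + 3 * σ2 / s ^ 2) := by gcongr
    _ = (-(Δ * S ^ 2 * t ^ 2 / 8) + Δ * S ^ 2 / 2 + 3 * (Δ * σ2)) / s ^ 2 := by
        field_simp
        ring
    -- The 4 is generous: `Δ S²/2 + 3 Δ σ²` is at most `3 s²`.
    _ ≤ -(a * t ^ 2 / 8) + 4 := by
        rw [div_le_iff₀ hs2pos]
        nlinarith [mul_nonneg hΔ hσ0, mul_nonneg hΔ (sq_nonneg S),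
          mul_le_mul_of_nonneg_right ha (sq_nonneg t)]

/-! ### Derivative bounds from Cauchy's estimate. -/

theorem iteratedDeriv_comp_ofReal {F : ℂ → ℂ} (hF : ContDiff ℂ ⊤ F) (k : ℕ) (t : ℝ) :
    iteratedDeriv k (fun x : ℝ ↦ F x) t = iteratedDeriv k F t := by
  induction k generalizing t with
  | zero => simp
  | succ k ih =>
    rw [iteratedDeriv_succ, iteratedDeriv_succ, funext ih]
    exact ((hF.differentiable_iteratedDeriv k (by exact_mod_cast WithTop.coe_lt_top _)
      (t : ℂ)).hasDerivAt).comp_ofReal.deriv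

/-- Crude but sufficient: `k² ≲ L²` is what Gaussian decay absorbs once `t ≳ L`. -/
theorem factorial_le_exp_sq (k : ℕ) : (k.factorial : ℝ) ≤ Real.exp ((k : ℝ) ^ 2) := by
  have h1 : (k.factorial : ℝ) ≤ (k : ℝ) ^ k := by exact_mod_cast Nat.factorial_le_pow k
  have h2 : (k : ℝ) ≤ Real.exp k := by linarith [Real.add_one_le_exp (k : ℝ)]
  calc (k.factorial : ℝ) ≤ (k : ℝ) ^ k := h1
    _ ≤ Real.exp k ^ k := by gcongr
    _ = _ := by rw [← Real.exp_nat_mul, sq]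

theorem one_le_log_max_exp_one (x : ℝ) : 1 ≤ Real.log (max (Real.exp 1) x) := by
  rw [Real.le_log_iff_exp_le (lt_max_of_lt_left (Real.exp_pos 1))]
  exact le_max_left _ _

theorem exp_neg_four_log_max_le {n : ℕ} (hn : 1 ≤ n) :
    Real.exp (-(4 * Real.log (max (Real.exp 1) n))) ≤ ((n : ℝ) ^ 4)⁻¹ := by
  have hn0 : (0 : ℝ) < n := by exact_mod_cast hn
  rw [Real.exp_neg]
  gcongr
  rw [show (4 : ℝ) = ((4 : ℕ) : ℝ) by norm_num, Real.exp_nat_mul,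
    Real.exp_log (lt_max_of_lt_left (Real.exp_pos 1))]
  gcongr
  exact le_max_right _ _

theorem norm_iteratedDeriv_sq_le {F : ℂ → ℂ} (hF : Differentiable ℂ F) {a t L : ℝ} {n k : ℕ}
    (ha0 : 0 < a) (ha1 : a ≤ 1) (hn : 1 ≤ n) (hL : L = Real.log (max (Real.exp 1) n))
    (hk : (k : ℝ) ≤ 401 * L) (ht : 8 * (401 ^ 2 + 13) / a * L < t)
    (hbd : ∀ t : ℝ, 2 ≤ t → ∀ z : ℂ, ‖z - t‖ ≤ 1 → ‖F z‖ ≤ Real.exp (-(a * t ^ 2 / 8) + 4)) :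
    ‖iteratedDeriv k F t‖ ^ 2 ≤ (k.factorial : ℝ) * ((n : ℝ) ^ 4)⁻¹ * Real.exp (-t) := by
  have hL1 : 1 ≤ L := hL ▸ one_le_log_max_exp_one n
  have hat : 8 * (401 ^ 2 + 13) * L < a * t := by
    rw [div_mul_eq_mul_div, div_lt_iff₀ ha0] at ht
    linarith
  have ht0 : 0 < t := by
    by_contra! h
    nlinarith
  have htL : 8 * (401 ^ 2 + 13) * L < t := by nlinarith
  have ht2 : 2 ≤ t := by linarith
  have hC := Complex.norm_iteratedDeriv_le_of_forall_mem_sphere_norm_le (c := (t : ℂ)) (f := F) k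
    one_pos hF.diffContOnCl (fun z hz ↦ hbd t ht2 z (by rw [← dist_eq_norm]; exact le_of_eq hz))
  rw [one_pow, div_one] at hC
  have hk2 : (k : ℝ) ^ 2 ≤ 401 ^ 2 * L ^ 2 := by
    rw [← mul_pow]; gcongr
  -- The cutoff constant is tuned to this: `401²` pays for `k²`, and `13 = 8 + 4 + 1` for the terms
  -- `8`, `4 L` and `t`.
  have hmain : (k : ℝ) ^ 2 + 2 * (-(a * t ^ 2 / 8) + 4) ≤ -(4 * L) - t := by
    have h1 : 8 * (401 ^ 2 + 13) * L * t ≤ a * t * t := by gcongr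
    have h2 : L * (8 * (401 ^ 2 + 13) * L) ≤ L * t := by gcongr
    have h3 : 1 * t ≤ L * t := by gcongr
    nlinarith
  calc ‖iteratedDeriv k F t‖ ^ 2 ≤ (k.factorial * Real.exp (-(a * t ^ 2 / 8) + 4)) ^ 2 := by gcongr
    _ = k.factorial * (k.factorial * Real.exp (2 * (-(a * t ^ 2 / 8) + 4))) := by
        rw [mul_pow, ← Real.exp_nat_mul]; push_cast; ring
    _ ≤ k.factorial * (Real.exp ((k : ℝ) ^ 2) * Real.exp (2 * (-(a * t ^ 2 / 8) + 4))) := by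
        gcongr; exact factorial_le_exp_sq k
    _ ≤ k.factorial * (Real.exp (-(4 * L)) * Real.exp (-t)) := by
        rw [← Real.exp_add, ← Real.exp_add]; gcongr _ * ?_; exact Real.exp_le_exp.2 (by linarith)
    _ ≤ k.factorial * (((n : ℝ) ^ 4)⁻¹ * Real.exp (-t)) := by
        gcongr; rw [hL]; exact exp_neg_four_log_max_le hn
    _ = _ := by ring

/-! ### Conclusion. -/

theorem mainTheorem9 (cS : ℝ) (hcS : 0 < cS) :
    ∃ c : ℝ, 0 < c ∧
      ∀ {Ω : Type*} [MeasurableSpace Ω] (P : Measure Ω) [IsProbabilityMeasure P]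
        (X : ℝ≥0 → Ω → ℝ) (b S : ℝ) (ν : Measure ℝ) (ε : ℝ) (Δ : ℝ≥0) (n : ℕ),
        0 < ε → 0 < Δ → 1 ≤ n → 0 ≤ S →
        IsLevyMeasure ν → ν {x : ℝ | ε < |x|} = 0 →
        IsLevyProcess X P b S ν →
        ENNReal.ofReal (1 / (Δ : ℝ)) < jumpIntensity ν 0 ε →
        ε ≤ √(Δ * (S ^ 2 + smallJumpVar ν ε)) →
        √(smallJumpVar ν ε) ≤ cS * S →
        ∀ k : ℕ, (k : ℝ) ≤ 401 * Real.log (max (Real.exp 1) n) →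
          ContDiff ℝ k (Psi X P b S ν ε Δ) ∧
          IntegrableOn (fun t ↦ ‖iteratedDeriv k (Psi X P b S ν ε Δ) t‖ ^ 2)
            (Set.Ioi (c * Real.log (max (Real.exp 1) n))) ∧
          ∫ t in Set.Ioi (c * Real.log (max (Real.exp 1) n)),
              ‖iteratedDeriv k (Psi X P b S ν ε Δ) t‖ ^ 2
            ≤ (k.factorial : ℝ) * ((n : ℝ) ^ 4)⁻¹ := by
  -- From `σ² ≤ cS² S²`, the Gaussian share `S² / (S² + σ²)` is at least `a`.
  set a : ℝ := 1 / (1 + cS ^ 2) with ha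
  have ha0 : 0 < a := by positivity
  have ha1 : a ≤ 1 := by
    rw [ha, div_le_one (by positivity)]
    nlinarith
  refine ⟨8 * (401 ^ 2 + 13) / a, by positivity, ?_⟩
  intro Ω _ P _ X b S ν ε Δ n hε hΔ hn hS hν hsupp hX _ hεs hσS k hk
  have hae : ∀ᵐ x ∂ν, |x| ≤ ε := by
    rw [ae_iff]
    simpa only [not_le] using hsupp
  have h2 := hν.integrable_sq hae
  have hv0 := smallJumpVar_nonneg ν ε
  have hΔ' : (0 : ℝ) < Δ := hΔ
  have hs : 0 < √(Δ * (S ^ 2 + smallJumpVar ν ε)) := hε.trans_le hεs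
  have hvS : smallJumpVar ν ε ≤ cS ^ 2 * S ^ 2 := by
    rw [← mul_pow]
    exact (Real.sqrt_le_left (by positivity)).1 hσS
  -- `S = 0` would force `σ = 0`, against `0 < ε ≤ s`; so the no-jump term of `Psi` vanishes.
  have hS0 : S ≠ 0 := by
    rintro rfl
    have : smallJumpVar ν ε = 0 := le_antisymm (by simpa using hvS) hv0
    simp [this] at hs
  have hs2 : √(Δ * (S ^ 2 + smallJumpVar ν ε)) ^ 2 = Δ * (S ^ 2 + smallJumpVar ν ε) :=
    Real.sq_sqrt (by positivity)
  have haS : a * √(Δ * (S ^ 2 + smallJumpVar ν ε)) ^ 2 ≤ Δ * S ^ 2 := by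
    rw [hs2, ha, one_div_mul_eq_div, div_le_iff₀ (by positivity), mul_assoc]
    gcongr
    linarith
  rw [Psi_eq_rescaledCharFunExtension hS0 hX hae h2 Δ]
  set s := √(Δ * (S ^ 2 + smallJumpVar ν ε)) with hsdef
  set F := rescaledCharFunExtension S ν Δ s with hF
  have hFd : Differentiable ℂ F := differentiable_rescaledCharFunExtension hae h2 S Δ s
  have hFc : ContDiff ℂ ⊤ F := hFd.contDiff
  have hcont (m : ℕ) : ContDiff ℝ m (fun t : ℝ ↦ F t) :=
    ((hFd.contDiff (n := m)).restrict_scalars ℝ).comp Complex.ofRealCLM.contDiff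
  set L := Real.log (max (Real.exp 1) n) with hL
  set A : ℝ := 8 * (401 ^ 2 + 13) / a * L with hA
  have hA0 : 0 ≤ A := by
    have : 1 ≤ L := one_le_log_max_exp_one n
    positivity
  have hpt : ∀ t ∈ Set.Ioi A, ‖iteratedDeriv k (fun t : ℝ ↦ F t) t‖ ^ 2
      ≤ (k.factorial : ℝ) * ((n : ℝ) ^ 4)⁻¹ * Real.exp (-t) := by
    intro t ht
    rw [iteratedDeriv_comp_ofReal hFc]
    refine norm_iteratedDeriv_sq_le hFd ha0 ha1 hn hL hk ht fun t ht z hz ↦ ?_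
    refine norm_rescaledCharFunExtension_le hae h2 hΔ'.le hs ?_ hεs haS ht hz
    rw [← smallJumpVar_eq_integral hae]
    exact hs2
  have hexp : IntegrableOn (fun t ↦ (k.factorial : ℝ) * ((n : ℝ) ^ 4)⁻¹ * Real.exp (-t))
      (Set.Ioi A) := (integrableOn_exp_neg_Ioi A).const_mul _
  have hint : IntegrableOn (fun t ↦ ‖iteratedDeriv k (fun t : ℝ ↦ F t) t‖ ^ 2) (Set.Ioi A) := by
    refine Integrable.mono' hexp ?_ ?_
    · exact (((hcont k).continuous_iteratedDeriv k le_rfl).norm.pow 2).aestronglyMeasurable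
    · refine (ae_restrict_mem measurableSet_Ioi).mono fun t ht ↦ ?_
      rw [Real.norm_of_nonneg (by positivity)]
      exact hpt t ht
  refine ⟨hcont k, hint, (setIntegral_mono_on hint hexp measurableSet_Ioi hpt).trans ?_⟩
  rw [integral_const_mul, integral_exp_neg_Ioi]
  exact mul_le_of_le_one_right (by positivity) (Real.exp_le_one_iff.2 (by linarith))
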